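/- Let $T>0$, let $f_0\colon\mathbb R^d\to\mathbb R^d$ and $f\colon\mathbb R^d\to\mathbb R^{d\times m}$ be globally Lipschitz, let $c\colon\mathbb R^d\to\mathbb R^p$ be locally Lipschitz (Lipschitz on every ball), and let $x_0\in\mathbb R^d$. Let $\mathcal K\subset L^2([0,T];\mathbb R^m)$ be compact. For a control $u$ let $x(\cdot;u)$ be the solution on $[0,T]$ of $$\dot x(t)=f_0(x(t))+f(x(t))u(t),\qquad x(0)=x_0,$$ that is, the continuous function with $x(t)=x_0+\int_0^t \big(f_0(x(s))+f(x(s))u(s)\big)\,\mathrm ds$ for all $t\in[0,T]$, and put $y(t;u)=c(x(t;u))$. Let $\hat U(t)=(t,U(t)^\top)^\top\in\mathbb R^{m+1}$ with $U(t)=\int_0^t u(s)\,\mathrm ds$. For $0\le t\le T$ let $S_{0,t}(\hat U)$ be the signature of $\hat U$ over $[0,t]$, i.e. the family, indexed by all $k\ge 0$ and all words $(i_1,\dots,i_k)$ in $m+1$ letters, of the iterated Riemann–Stieltjes integrals $$\int_{0<s_1<\dots<s_k<t}\mathrm d\hat U_{i_1}(s_1)\cdots\mathrm d\hat U_{i_k}(s_k)$$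 (equal to $1$ for the empty word). Let $\mathcal W_{m+1}=\bigoplus_{k\ge0}\mathbb R^{(m+1)^k}$ be the space of families of real weights on these words of which only finitely many are nonzero, and let $\langle\ell,S\rangle=\sum_w \ell_w S_w$. Then for every $i\in\{1,\dots,p\}$ and every $\varepsilon>0$ there is an $\ell_i\in\mathcal W_{m+1}$ such that $$\sup_{t\in[0,T]}\ \sup_{u\in\mathcal K}\ \big|y_i(t;u)-\langle \ell_i,S_{0,t}(\hat U)\rangle\big|<\varepsilon .$$ -/

import Mathlib

open MeasureTheory Set
open scoped ENNReal NNReal Matrix Matrix.Norms.L2Operator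

namespace SigControl

/-- The Hilbert space `L²([0,T]; ℝᵐ)` of controls. -/
abbrev Control (T : ℝ) (m : ℕ) : Type :=
  Lp (EuclideanSpace ℝ (Fin m)) 2 (volume.restrict (Icc (0 : ℝ) T))

/-- `I` is the Riemann–Stieltjes integral of `g` against `X` over `[a, b]`: the tagged sums
`∑ i < n, g (ξ i) * (X (t (i + 1)) - X (t i))` over partitions `a = t 0 ≤ ⋯ ≤ t n = b` with tags
`ξ i ∈ [t i, t (i + 1)]` converge to `I` as the mesh tends to zero. -/
def HasStieltjesIntegral (g X : ℝ → ℝ) (a b I : ℝ) : Prop :=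
  ∀ ε > 0, ∃ δ > 0, ∀ (n : ℕ) (t ξ : ℕ → ℝ), Monotone t → t 0 = a → t n = b →
    (∀ i < n, t (i + 1) - t i < δ) → (∀ i < n, ξ i ∈ Icc (t i) (t (i + 1))) →
    |∑ i ∈ Finset.range n, g (ξ i) * (X (t (i + 1)) - X (t i)) - I| < ε

/-- A Riemann–Stieltjes integral over `[a, b]` with `a ≤ b` is unique. -/
theorem HasStieltjesIntegral.unique {g X : ℝ → ℝ} {a b I J : ℝ} (hab : a ≤ b)
    (hI : HasStieltjesIntegral g X a b I) (hJ : HasStieltjesIntegral g X a b J) : I = J := by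
  refine eq_of_forall_dist_le fun ε hε => ?_
  obtain ⟨δ, hδ, h₁⟩ := hI (ε / 2) (half_pos hε)
  obtain ⟨δ', hδ', h₂⟩ := hJ (ε / 2) (half_pos hε)
  obtain ⟨N, hN⟩ := exists_nat_gt ((b - a) / min δ δ')
  have hm : 0 < min δ δ' := lt_min hδ hδ'
  have hNpos : (0 : ℝ) < N := lt_of_le_of_lt (div_nonneg (sub_nonneg.2 hab) hm.le) hN
  have hstep : (b - a) / N < min δ δ' := by
    rw [div_lt_iff₀ hNpos]
    rw [div_lt_iff₀ hm] at hN
    linarith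
  let t : ℕ → ℝ := fun i => a + i * ((b - a) / N)
  have hst : 0 ≤ (b - a) / (N : ℝ) := div_nonneg (sub_nonneg.2 hab) hNpos.le
  have ht : Monotone t := fun i j hij => by
    have : (i : ℝ) ≤ j := by exact_mod_cast hij
    simp only [t]
    gcongr
  have hdiff : ∀ i, t (i + 1) - t i = (b - a) / N := fun i => by
    simp only [t]
    push_cast
    ring
  have h0 : t 0 = a := by simp [t]
  have hn : t N = b := by
    simp only [t]
    field_simp
    ring
  have e₁ := h₁ N t t ht h0 hn (fun i _ => by rw [hdiff]; exact hstep.trans_le (min_le_left _ _))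
    (fun i _ => ⟨le_rfl, ht (Nat.le_succ i)⟩)
  have e₂ := h₂ N t t ht h0 hn (fun i _ => by rw [hdiff]; exact hstep.trans_le (min_le_right _ _))
    (fun i _ => ⟨le_rfl, ht (Nat.le_succ i)⟩)
  rw [Real.dist_eq]
  rw [abs_lt] at e₁ e₂
  rw [abs_le]
  constructor <;> linarith [e₁.1, e₁.2, e₂.1, e₂.2]

open Classical in
/-- The Riemann–Stieltjes integral `∫_a^b g dX` (and `0` where it does not exist; it exists for
continuous `g` and `X` of bounded variation). -/
noncomputable def stieltjesIntegral (g X : ℝ → ℝ) (a b : ℝ) : ℝ :=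
  if h : ∃ I, HasStieltjesIntegral g X a b I then h.choose else 0

/-- Auxiliary recursion for iterated integrals, the letter of the outermost integral coming
first: `iterInt X a [iₖ, …, i₁] b = ∫_{a<s₁<⋯<sₖ<b} dX_{i₁}(s₁) ⋯ dX_{iₖ}(sₖ)`. -/
noncomputable def iterInt {n : ℕ} (X : ℝ → EuclideanSpace ℝ (Fin n)) (a : ℝ) :
    List (Fin n) → ℝ → ℝ
  | [], _ => 1
  | i :: w, b => stieltjesIntegral (fun s => iterInt X a w s) (fun s => X s i) a b

/-- The signature `S_{a,b}(X)`: its coordinate at the word `[i₁, …, iₖ]` is the coordinate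
`(i₁, …, iₖ)` of the tensor `∫_{a<s₁<⋯<sₖ<b} dX(s₁) ⊗ ⋯ ⊗ dX(sₖ)`, and it is `1` at the empty
word. -/
noncomputable def signature {n : ℕ} (X : ℝ → EuclideanSpace ℝ (Fin n)) (a b : ℝ) :
    List (Fin n) → ℝ :=
  fun w => iterInt X a w.reverse b

/-- `𝒲ₙ = ⨁ₖ ℝ^{nᵏ}`: finitely many real weights, indexed by words in `n` letters (the words of
length `k` index the coordinates of `ℝ^{nᵏ}`). -/
abbrev Weights (n : ℕ) : Type := List (Fin n) →₀ ℝ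

/-- The linear functional `⟨ℓ, S⟩ = ∑_w ℓ_w S_w`. -/
noncomputable def pairing {n : ℕ} (l : Weights n) (S : List (Fin n) → ℝ) : ℝ :=
  l.sum fun w r => r * S w

/-- The integral `U(t) = ∫_0^t u(s) ds` of a control. -/
noncomputable def integralPath {T : ℝ} {m : ℕ} (u : Control T m) (t : ℝ) :
    EuclideanSpace ℝ (Fin m) :=
  ∫ s in (0 : ℝ)..t, u s

/-- The time extension `t ↦ (t, U(t))` of a path `U`. -/
def timeExtend {m : ℕ} (U : ℝ → EuclideanSpace ℝ (Fin m)) (t : ℝ) :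
    EuclideanSpace ℝ (Fin (m + 1)) :=
  WithLp.toLp 2 (Fin.cons t (U t).ofLp)

/-- The right-hand side `f₀(x) + f(x) v` of the controlled equation. -/
def drift {d m : ℕ} (f₀ : EuclideanSpace ℝ (Fin d) → EuclideanSpace ℝ (Fin d))
    (f : EuclideanSpace ℝ (Fin d) → Matrix (Fin d) (Fin m) ℝ)
    (x : EuclideanSpace ℝ (Fin d)) (v : EuclideanSpace ℝ (Fin m)) : EuclideanSpace ℝ (Fin d) :=
  f₀ x + WithLp.toLp 2 (f x *ᵥ v.ofLp)

/-- `x : [0,T] → ℝᵈ` is a (Carathéodory) solution of `ẋ = f₀(x) + f(x) u`, `x(0) = x₀`: it is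
continuous, the right-hand side is integrable along it, and
`x(t) = x₀ + ∫_0^t (f₀(x(s)) + f(x(s)) u(s)) ds` on `[0,T]`. Equivalently, `x` is absolutely
continuous, solves the equation almost everywhere and starts at `x₀`. -/
structure IsSolution {d m : ℕ} {T : ℝ}
    (f₀ : EuclideanSpace ℝ (Fin d) → EuclideanSpace ℝ (Fin d))
    (f : EuclideanSpace ℝ (Fin d) → Matrix (Fin d) (Fin m) ℝ) (x₀ : EuclideanSpace ℝ (Fin d))
    (u : Control T m) (x : ℝ → EuclideanSpace ℝ (Fin d)) : Prop where
  continuousOn : ContinuousOn x (Icc 0 T)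
  integrableOn : IntegrableOn (fun s => drift f₀ f (x s) (u s)) (Icc 0 T)
  eq_integral : ∀ t ∈ Icc 0 T, x t = x₀ + ∫ s in (0 : ℝ)..t, drift f₀ f (x s) (u s)

end SigControl

/-! This is a Stone–Weierstrass argument on the compact space `[0,T] × K`. Linear functionals of the
signature form an algebra of functions of `(t, u)`: by the product rule, a product of two iterated
integrals is a shuffle sum of iterated integrals (`exists_pairing_eq_controlIter_mul`). They are
continuous because iterated integrals over `[0,T]` converge uniformly when the controls converge in
`L²` (`tendstoUniformlyOn_controlIter`). The output is continuous by a Grönwall estimate in the `L¹`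
distance of the controls (`IsSolution.norm_sub_le`, `tendstoUniformlyOn_solution`).

The algebra does not separate points: controls that agree up to time `t` have the same signature
over `[0,t]`. But Stone–Weierstrass also holds in a fibre form, where the target only has to be
constant wherever all elements of the algebra agree
(`Subalgebra.mem_topologicalClosure_of_constant_on_fibres`). The single letter `0` recovers `t`. The
words made of `k` time integrations followed by one integration against `U_i` give the moments of
`u_i` on `[0,t]`, which determine `u` almost everywhere there (`control_ae_eq_of_controlIter_eq`).
The state at time `t` depends on nothing else (`IsSolution.eq_of_ae_eq`). -/

/-! ### General tools: Stone–Weierstrass on fibres, product rule, Grönwall, moments. -/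

open Filter Topology in
/-- A continuous function on a compact space that is constant on the joint fibres of a subalgebra of
`C(X, ℝ)` lies in the closure of the subalgebra. -/
theorem Subalgebra.mem_topologicalClosure_of_constant_on_fibres {X : Type*} [TopologicalSpace X]
    [CompactSpace X] (A : Subalgebra ℝ C(X, ℝ)) (f : C(X, ℝ))
    (hf : ∀ x y, (∀ g ∈ A, g x = g y) → f x = f y) : f ∈ A.topologicalClosure := by
  -- On the quotient by the joint fibres, the descended functions separate points, so the usual
  -- Stone–Weierstrass theorem applies there.
  let r : Setoid X :=
    { r := fun x y => ∀ g ∈ A, g x = g y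
      iseqv := ⟨fun _ _ _ => rfl, fun h g hg => (h g hg).symm,
        fun h h' g hg => (h g hg).trans (h' g hg)⟩ }
  let q : C(X, Quotient r) := ⟨Quotient.mk r, continuous_quotient_mk'⟩
  let φ := ContinuousMap.compRightAlgHom ℝ ℝ q
  have hsep : (A.comap φ).SeparatesPoints := by
    intro a b
    induction a using Quotient.inductionOn with | _ x =>
    induction b using Quotient.inductionOn with | _ y =>
    intro hne
    have : ¬ ∀ g ∈ A, g x = g y := fun h => hne (Quotient.sound h)
    push Not at this
    obtain ⟨g, hg, hgne⟩ := this
    let g' : C(Quotient r, ℝ) :=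
      ⟨Quotient.lift g fun a b h => h g hg, g.continuous.quotient_lift _⟩
    refine ⟨g', ⟨g', ?_, rfl⟩, hgne⟩
    have : φ g' = g := by ext; rfl
    show φ g' ∈ A
    rwa [this]
  have htop := ContinuousMap.subalgebra_topologicalClosure_eq_top_of_separatesPoints _ hsep
  let f' : C(Quotient r, ℝ) :=
    ⟨Quotient.lift f fun a b h => hf a b h, f.continuous.quotient_lift _⟩
  have hf' : f' ∈ closure ((A.comap φ : Subalgebra ℝ C(Quotient r, ℝ)) : Set C(Quotient r, ℝ)) := by
    have : f' ∈ (A.comap φ).topologicalClosure := htop ▸ Algebra.mem_top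
    exact this
  -- Pulling back along the quotient map is continuous, so it carries the approximation on the
  -- quotient back to `X`.
  have hφ : Continuous φ := ContinuousMap.continuous_precomp q
  have : φ f' ∈ closure (A : Set C(X, ℝ)) :=
    map_mem_closure hφ hf' fun g hg => hg
  have e : φ f' = f := by ext; rfl
  rw [e] at this
  exact this

open Filter Topology in
/-- Functions continuous on `s` that depend uniformly continuously on a parameter are jointly
continuous. -/
theorem continuous_uncurry_of_tendstoUniformlyOn {α β E : Type*} [TopologicalSpace α]
    [TopologicalSpace β] [PseudoMetricSpace E] {s : Set β} {K : Set α} {h : α → β → E}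
    (hc : ∀ v ∈ K, ContinuousOn (h v) s)
    (hu : ∀ v ∈ K, TendstoUniformlyOn h (h v) (𝓝[K] v) s) :
    Continuous fun p : s × K => h p.2 p.1 := by
  rw [continuous_iff_continuousAt]
  rintro ⟨⟨t, ht⟩, ⟨v, hv⟩⟩
  rw [ContinuousAt, Metric.tendsto_nhds]
  intro ε hε
  have h1 : ∀ᶠ p : s × K in 𝓝 (⟨⟨t, ht⟩, ⟨v, hv⟩⟩ : s × K),
      ∀ r ∈ s, dist (h v r) (h p.2 r) < ε / 2 := by
    have := (Metric.tendstoUniformlyOn_iff.1 (hu v hv)) (ε / 2) (half_pos hε)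
    have h2 : Tendsto (fun p : s × K => (p.2 : α)) (𝓝 (⟨⟨t, ht⟩, ⟨v, hv⟩⟩ : s × K)) (𝓝[K] v) :=
      tendsto_nhdsWithin_iff.2 ⟨(continuous_subtype_val.comp continuous_snd).tendsto _,
        Eventually.of_forall fun p => p.2.2⟩
    exact h2.eventually this
  have h3 : ∀ᶠ p : s × K in 𝓝 (⟨⟨t, ht⟩, ⟨v, hv⟩⟩ : s × K), dist (h v p.1) (h v t) < ε / 2 := by
    have h2 : Tendsto (fun p : s × K => (p.1 : β)) (𝓝 (⟨⟨t, ht⟩, ⟨v, hv⟩⟩ : s × K)) (𝓝[s] t) :=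
      tendsto_nhdsWithin_iff.2 ⟨(continuous_subtype_val.comp continuous_fst).tendsto _,
        Eventually.of_forall fun p => p.1.2⟩
    exact h2.eventually (Metric.tendsto_nhds.1 (hc v hv t ht) (ε / 2) (half_pos hε))
  filter_upwards [h1, h3] with p hp1 hp2
  have := hp1 p.1 p.1.2
  rw [dist_comm] at this
  linarith [dist_triangle (h p.2 p.1) (h v p.1) (h v t)]

/-- Product rule for primitives of integrable functions. -/
theorem integral_primitive_mul_primitive {g h G H : ℝ → ℝ} {t : ℝ} (ht : 0 ≤ t)
    (hg : IntervalIntegrable g volume 0 t) (hh : IntervalIntegrable h volume 0 t)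
    (hG : ∀ s ∈ Icc 0 t, G s = ∫ r in (0 : ℝ)..s, g r)
    (hH : ∀ s ∈ Icc 0 t, H s = ∫ r in (0 : ℝ)..s, h r) :
    G t * H t = ∫ s in (0 : ℝ)..t, (g s * H s + G s * h s) := by
  have h0 : (0 : ℝ) ∈ uIcc 0 t := by simp
  have e := AbsolutelyContinuousOnInterval.integral_deriv_mul_eq_sub
    (hg.absolutelyContinuousOnInterval_intervalIntegral h0)
    (hh.absolutelyContinuousOnInterval_intervalIntegral h0)
  rw [intervalIntegral.integral_same, zero_mul, sub_zero, ← hG t ⟨ht, le_rfl⟩,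
    ← hH t ⟨ht, le_rfl⟩] at e
  rw [← e]
  apply intervalIntegral.integral_congr_ae
  filter_upwards [hg.ae_hasDerivAt_integral, hh.ae_hasDerivAt_integral] with s h1 h2 hs
  have hs' := uIoc_subset_uIcc hs
  rw [(h1 hs' 0 h0).deriv, (h2 hs' 0 h0).deriv]
  rw [uIcc_of_le ht] at hs'
  rw [hG s hs', hH s hs']

/-- Lets the integrating factor `exp (-E)` in Grönwall's inequality be treated by the fundamental
theorem of calculus for absolutely continuous functions. -/
theorem LipschitzOnWith.comp_absolutelyContinuousOnInterval {E F : Type*} [PseudoMetricSpace E]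
    [PseudoMetricSpace F] {φ : E → F} {S : Set E} {C : ℝ≥0} {g : ℝ → E} {a b : ℝ}
    (hφ : LipschitzOnWith C φ S) (hg : AbsolutelyContinuousOnInterval g a b)
    (hS : MapsTo g (uIcc a b) S) : AbsolutelyContinuousOnInterval (φ ∘ g) a b := by
  rw [absolutelyContinuousOnInterval_iff] at hg ⊢
  intro ε hε
  -- The `+ 1` keeps the quotient meaningful when `C = 0`.
  obtain ⟨δ, hδ, h⟩ := hg (ε / (C + 1)) (by positivity)
  refine ⟨δ, hδ, fun E hE hlt => ?_⟩
  have h1 := h E hE hlt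
  rw [lt_div_iff₀ (by positivity)] at h1
  refine lt_of_le_of_lt ?_ h1
  rw [Finset.sum_mul]
  refine Finset.sum_le_sum fun i hi => ?_
  have hm := hE.1 i hi
  refine (hφ.dist_le_mul _ (hS hm.1) _ (hS hm.2)).trans ?_
  rw [mul_comm]
  gcongr
  linarith

/-- Grönwall's inequality with an integrable kernel. -/
theorem le_mul_exp_of_le_add_integral {z a : ℝ → ℝ} {C t : ℝ} (ht : 0 ≤ t)
    (hz : ContinuousOn z (Icc 0 t)) (ha : IntervalIntegrable a volume 0 t) (ha0 : ∀ s, 0 ≤ a s)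
    (h : ∀ s ∈ Icc 0 t, z s ≤ C + ∫ r in (0 : ℝ)..s, a r * z r) :
    z t ≤ C * Real.exp (∫ r in (0 : ℝ)..t, a r) := by
  have h0 : (0 : ℝ) ∈ uIcc 0 t := by simp
  have haz : IntervalIntegrable (fun r => a r * z r) volume 0 t :=
    ha.mul_continuousOn (by rwa [uIcc_of_le ht])
  set E : ℝ → ℝ := fun s => ∫ r in (0 : ℝ)..s, a r with hE
  set I : ℝ → ℝ := fun s => ∫ r in (0 : ℝ)..s, a r * z r with hI
  have hEac : AbsolutelyContinuousOnInterval E 0 t :=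
    ha.absolutelyContinuousOnInterval_intervalIntegral h0
  have hIac : AbsolutelyContinuousOnInterval (fun s => C + I s) 0 t :=
    (LipschitzWith.const C).lipschitzOnWith.absolutelyContinuousOnInterval.add
      (haz.absolutelyContinuousOnInterval_intervalIntegral h0)
  -- The restriction to `Ici 0` suffices because `a ≥ 0` makes its primitive `E` nonnegative.
  have hexp : LipschitzOnWith 1 (fun y : ℝ => Real.exp (-y)) (Ici 0) := by
    refine (convex_Ici 0).lipschitzOnWith_of_nnnorm_deriv_le (𝕜 := ℝ) (fun y _ => by fun_prop) ?_
    intro y hy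
    have : HasDerivAt (fun y : ℝ => Real.exp (-y)) (Real.exp (-y) * -1) y :=
      (Real.hasDerivAt_exp (-y)).comp y (hasDerivAt_neg y)
    rw [this.deriv, ← NNReal.coe_le_coe]
    simp only [coe_nnnorm, Real.norm_eq_abs, NNReal.coe_one]
    rw [abs_mul, Real.abs_exp]
    simpa using hy
  have hE0 : MapsTo E (uIcc 0 t) (Ici 0) := by
    intro s hs
    rw [uIcc_of_le ht] at hs
    exact intervalIntegral.integral_nonneg hs.1 fun r _ => ha0 r
  have hPac : AbsolutelyContinuousOnInterval (fun s => Real.exp (-E s)) 0 t :=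
    hexp.comp_absolutelyContinuousOnInterval hEac hE0
  have e := AbsolutelyContinuousOnInterval.integral_deriv_mul_eq_sub hIac hPac
  -- Almost everywhere `(C + I) * exp (-E)` has derivative `-a * exp (-E) * (C + I - z)`, which is
  -- nonpositive by hypothesis; so its value at `t` is at most its value `C` at `0`.
  have hle : (∫ s in (0 : ℝ)..t, (deriv (fun s => C + I s) s * Real.exp (-E s) +
      (C + I s) * deriv (fun s => Real.exp (-E s)) s)) ≤ 0 := by
    rw [← neg_nonneg, ← intervalIntegral.integral_neg]
    refine intervalIntegral.integral_nonneg_of_ae_restrict ht ?_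
    rw [Filter.EventuallyLE, ae_restrict_iff' measurableSet_Icc]
    filter_upwards [ha.ae_hasDerivAt_integral, haz.ae_hasDerivAt_integral] with s h1 h2 hs
    have hs' : s ∈ uIcc 0 t := by rwa [uIcc_of_le ht]
    have d1 : HasDerivAt (fun s => C + I s) (a s * z s) s := (h2 hs' 0 h0).const_add C
    have d2 : HasDerivAt (fun s => Real.exp (-E s)) (Real.exp (-E s) * (-a s)) s :=
      (h1 hs' 0 h0).neg.exp
    rw [d1.deriv, d2.deriv]
    have := mul_nonneg (mul_nonneg (ha0 s) (Real.exp_pos (-E s)).le) (sub_nonneg.2 (h s hs))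
    simp only [Pi.zero_apply]
    simp only [hI] at *
    nlinarith [this]
  rw [e] at hle
  have hE00 : E 0 = 0 := by simp [hE]
  have hI00 : I 0 = 0 := by simp [hI]
  simp only [hE00, hI00, neg_zero, Real.exp_zero, add_zero, mul_one] at hle
  have h3 : (C + I t) * Real.exp (-E t) ≤ C := by linarith
  rw [Real.exp_neg, ← div_eq_mul_inv, div_le_iff₀ (Real.exp_pos _)] at h3
  exact (h t ⟨ht, le_rfl⟩).trans h3

/-- An integrable function on `[0, t]` with vanishing moments vanishes almost everywhere. -/
theorem ae_eq_zero_of_moments {h : ℝ → ℝ} {t : ℝ} (ht : 0 ≤ t)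
    (hh : IntervalIntegrable h volume 0 t)
    (hm : ∀ k : ℕ, ∫ s in (0 : ℝ)..t, s ^ k * h s = 0) : ∀ᵐ s, s ∈ Ioo 0 t → h s = 0 := by
  have hcont : ∀ g : ℝ → ℝ, Continuous g → IntervalIntegrable (fun s => g s * h s) volume 0 t :=
    fun g hg => hh.continuousOn_mul hg.continuousOn
  have hpoly : ∀ p : Polynomial ℝ, ∫ s in (0 : ℝ)..t, p.eval s * h s = 0 := by
    intro p
    simp_rw [Polynomial.eval_eq_sum_range, Finset.sum_mul]
    rw [intervalIntegral.integral_finsetSum fun i _ => hcont _ (by fun_prop)]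
    refine Finset.sum_eq_zero fun i _ => ?_
    simp_rw [mul_assoc]
    rw [intervalIntegral.integral_const_mul, hm, mul_zero]
  -- Weierstrass approximation extends the vanishing from polynomials to continuous test functions.
  have hall : ∀ g : ℝ → ℝ, Continuous g → ∫ s in (0 : ℝ)..t, g s * h s = 0 := by
    intro g hg
    have hA : 0 ≤ ∫ s in (0 : ℝ)..t, |h s| :=
      intervalIntegral.integral_nonneg ht fun _ _ => abs_nonneg _
    refine eq_of_forall_dist_le fun ε hε => ?_
    obtain ⟨p, hp⟩ := exists_polynomial_near_of_continuousOn 0 t g hg.continuousOn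
      (ε / ((∫ s in (0 : ℝ)..t, |h s|) + 1)) (by positivity)
    have e : ∫ s in (0 : ℝ)..t, g s * h s = ∫ s in (0 : ℝ)..t, (g s - p.eval s) * h s := by
      simp_rw [sub_mul]
      rw [intervalIntegral.integral_sub (hcont _ hg) (hcont _ p.continuous), hpoly, sub_zero]
    rw [e, dist_zero_right]
    refine (intervalIntegral.norm_integral_le_integral_norm ht).trans ?_
    have : ∫ s in (0 : ℝ)..t, ‖(g s - p.eval s) * h s‖ ≤
        ∫ s in (0 : ℝ)..t, ε / ((∫ s in (0 : ℝ)..t, |h s|) + 1) * |h s| := by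
      refine intervalIntegral.integral_mono_on ht
        (hcont _ (hg.sub p.continuous)).norm (hh.abs.const_mul _) fun s hs => ?_
      rw [norm_mul, Real.norm_eq_abs, Real.norm_eq_abs]
      have := hp s hs
      rw [abs_sub_comm] at this
      gcongr
    refine this.trans ?_
    rw [intervalIntegral.integral_const_mul, div_mul_eq_mul_div, div_le_iff₀ (by positivity)]
    nlinarith
  refine isOpen_Ioo.ae_eq_zero_of_integral_contDiff_smul_eq_zero ?_ ?_
  · refine IntegrableOn.locallyIntegrableOn ?_
    exact ((intervalIntegrable_iff_integrableOn_Ioo_of_le ht).1 hh)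
  · intro g hg _ hsupp
    have h1 := hall g hg.continuous
    rw [intervalIntegral.integral_of_le ht, integral_Ioc_eq_integral_Ioo] at h1
    rw [← h1, setIntegral_eq_integral_of_forall_compl_eq_zero]
    · rfl
    · intro s hs
      have : g s = 0 := by
        by_contra hne
        exact hs (hsupp (subset_tsupport _ hne))
      rw [this, zero_mul]

/-! ### Riemann–Stieltjes integrals against primitives -/

namespace SigControl

/-- The Riemann–Stieltjes integral of a continuous function against a primitive. -/
theorem hasStieltjesIntegral_primitive {g X v : ℝ → ℝ} {a b : ℝ} (hab : a ≤ b)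
    (hg : ContinuousOn g (Icc a b)) (hv : IntervalIntegrable v volume a b)
    (hX : ∀ s ∈ Icc a b, ∀ t ∈ Icc a b, X t - X s = ∫ r in s..t, v r) :
    HasStieltjesIntegral g X a b (∫ r in a..b, g r * v r) := by
  intro ε hε
  have hA : 0 ≤ ∫ s in a..b, |v s| :=
    intervalIntegral.integral_nonneg hab fun _ _ => abs_nonneg _
  set A := ∫ s in a..b, |v s| with hAdef
  have huc := isCompact_Icc.uniformContinuousOn_of_continuous hg
  rw [Metric.uniformContinuousOn_iff] at huc
  -- With this modulus the total error is at most `ε / (A + 1) * A`, which is below `ε` even if `A =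
  -- 0`.
  obtain ⟨δ, hδ, hgδ⟩ := huc (ε / (A + 1)) (by positivity)
  refine ⟨δ, hδ, fun n t ξ ht h0 hn hmesh htag => ?_⟩
  have hmem : ∀ i ≤ n, t i ∈ Icc a b := fun i hi =>
    ⟨h0 ▸ ht (Nat.zero_le i), hn ▸ ht hi⟩
  have hsub : ∀ i < n, Icc (t i) (t (i + 1)) ⊆ Icc a b := fun i hi =>
    Icc_subset_Icc (hmem i hi.le).1 (hmem (i + 1) hi).2
  have hvi : ∀ i < n, IntervalIntegrable v volume (t i) (t (i + 1)) := fun i hi =>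
    hv.mono_set (by
      rw [uIcc_of_le (ht (Nat.le_succ i)), uIcc_of_le hab]
      exact hsub i hi)
  have hgvi : ∀ i < n, IntervalIntegrable (fun r => g r * v r) volume (t i) (t (i + 1)) :=
    fun i hi => (hvi i hi).continuousOn_mul (by
      rw [uIcc_of_le (ht (Nat.le_succ i))]
      exact hg.mono (hsub i hi))
  have e1 : ∫ r in a..b, g r * v r =
      ∑ i ∈ Finset.range n, ∫ r in t i..t (i + 1), g r * v r := by
    rw [intervalIntegral.sum_integral_adjacent_intervals hgvi, h0, hn]
  have e2 : A = ∑ i ∈ Finset.range n, ∫ r in t i..t (i + 1), |v r| := by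
    rw [intervalIntegral.sum_integral_adjacent_intervals fun i hi => (hvi i hi).abs, h0, hn]
  rw [e1, ← Finset.sum_sub_distrib]
  have hle : ∀ i ∈ Finset.range n,
      |g (ξ i) * (X (t (i + 1)) - X (t i)) - ∫ r in t i..t (i + 1), g r * v r| ≤
        ε / (A + 1) * ∫ r in t i..t (i + 1), |v r| := by
    intro i hi
    have hi := Finset.mem_range.1 hi
    have hii := ht (Nat.le_succ i)
    rw [hX _ (hmem i hi.le) _ (hmem (i + 1) hi), ← intervalIntegral.integral_const_mul,
      ← intervalIntegral.integral_sub ((hvi i hi).const_mul _) (hgvi i hi),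
      ← intervalIntegral.integral_const_mul, ← Real.norm_eq_abs]
    refine (intervalIntegral.norm_integral_le_integral_norm hii).trans ?_
    refine intervalIntegral.integral_mono_on hii
      (((hvi i hi).const_mul _).sub (hgvi i hi)).norm ((hvi i hi).abs.const_mul _) fun s hs => ?_
    rw [← sub_mul, norm_mul, Real.norm_eq_abs, Real.norm_eq_abs]
    refine mul_le_mul_of_nonneg_right ?_ (abs_nonneg _)
    refine (hgδ _ (hsub i hi (htag i hi)) _ (hsub i hi hs) ?_).le
    rw [Real.dist_eq, abs_lt]
    have h1 := htag i hi
    have h2 := hmesh i hi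
    constructor <;> linarith [h1.1, h1.2, hs.1, hs.2]
  refine (Finset.abs_sum_le_sum_abs _ _).trans_lt ((Finset.sum_le_sum hle).trans_lt ?_)
  rw [← Finset.mul_sum, ← e2, div_mul_eq_mul_div, div_lt_iff₀ (by positivity)]
  nlinarith

theorem stieltjesIntegral_eq {g X : ℝ → ℝ} {a b I : ℝ} (hab : a ≤ b)
    (h : HasStieltjesIntegral g X a b I) : stieltjesIntegral g X a b = I := by
  have hex : ∃ I, HasStieltjesIntegral g X a b I := ⟨I, h⟩
  rw [stieltjesIntegral, dif_pos hex]
  exact hex.choose_spec.unique hab h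

end SigControl

/-! ### Iterated integrals of a control and their algebraic and analytic properties -/

namespace SigControl

section
variable {T : ℝ} {m : ℕ}

/-- The derivative `(1, u)` of the time-extended integral of a control. -/
noncomputable def channel (u : Control T m) (j : Fin (m + 1)) (s : ℝ) : ℝ :=
  (Fin.cons 1 (fun i => u s i) : Fin (m + 1) → ℝ) j

@[simp] theorem channel_zero (u : Control T m) (s : ℝ) : channel u 0 s = 1 := rfl

@[simp] theorem channel_succ (u : Control T m) (i : Fin m) (s : ℝ) :
    channel u i.succ s = u s i := rfl

theorem abs_channel_sub_le (u v : Control T m) (j : Fin (m + 1)) (s : ℝ) :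
    |channel u j s - channel v j s| ≤ ‖u s - v s‖ := by
  refine Fin.cases ?_ (fun i => ?_) j
  · simp
  · simpa using PiLp.norm_apply_le (u s - v s) i

theorem integrableOn_control (u : Control T m) : IntegrableOn u (Icc 0 T) :=
  (Lp.memLp u).integrable one_le_two

theorem intervalIntegrable_of_integrableOn {E : Type*} [NormedAddCommGroup E] {g : ℝ → E}
    (hg : IntegrableOn g (Icc 0 T)) {s t : ℝ} (hs : s ∈ Icc 0 T) (ht : t ∈ Icc 0 T) :
    IntervalIntegrable g volume s t :=
  (hg.mono_set (ordConnected_Icc.uIcc_subset hs ht)).intervalIntegrable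

theorem intervalIntegrable_control (u : Control T m) {s t : ℝ} (hs : s ∈ Icc 0 T)
    (ht : t ∈ Icc 0 T) : IntervalIntegrable u volume s t :=
  intervalIntegrable_of_integrableOn (integrableOn_control u) hs ht

theorem intervalIntegrable_channel (u : Control T m) (j : Fin (m + 1)) {s t : ℝ}
    (hs : s ∈ Icc 0 T) (ht : t ∈ Icc 0 T) : IntervalIntegrable (channel u j) volume s t := by
  refine Fin.cases ?_ (fun i => ?_) j
  · exact intervalIntegrable_const (c := (1 : ℝ))
  · refine intervalIntegrable_of_integrableOn (T := T) ?_ hs ht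
    exact (EuclideanSpace.proj (𝕜 := ℝ) i).integrable_comp (integrableOn_control u)

theorem timeExtend_sub (u : Control T m) (j : Fin (m + 1)) {s t : ℝ} (hs : s ∈ Icc 0 T)
    (ht : t ∈ Icc 0 T) :
    timeExtend (integralPath u) t j - timeExtend (integralPath u) s j =
      ∫ r in s..t, channel u j r := by
  have h0 : (0 : ℝ) ∈ Icc 0 T := ⟨le_rfl, hs.1.trans hs.2⟩
  refine Fin.cases ?_ (fun i => ?_) j
  · simp [timeExtend]
  · have e : ∀ t ∈ Icc 0 T, integralPath u t i = ∫ r in (0 : ℝ)..t, u r i := fun t ht =>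
      ((EuclideanSpace.proj (𝕜 := ℝ) i).intervalIntegral_comp_comm
        (intervalIntegrable_control u h0 ht)).symm
    have h1 : ∀ t, timeExtend (integralPath u) t i.succ = integralPath u t i := fun t => by
      simp [timeExtend]
    rw [h1, h1, e t ht, e s hs]
    exact intervalIntegral.integral_interval_sub_left
      (intervalIntegrable_channel u i.succ h0 ht) (intervalIntegrable_channel u i.succ h0 hs)

/-- Iterated integrals of the time-extended integral of a control, the outermost letter first. -/
noncomputable abbrev controlIter (u : Control T m) (w : List (Fin (m + 1))) (t : ℝ) : ℝ :=
  iterInt (timeExtend (integralPath u)) 0 w t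

theorem controlIter_nil (u : Control T m) (t : ℝ) : controlIter u [] t = 1 := rfl

/-- The path is a primitive of `channel u`, so the Stieltjes integral becomes a Lebesgue integral
once the integrand is continuous. That assumption is removed by the induction in
`continuousOn_controlIter`. -/
theorem controlIter_cons_of_continuousOn (u : Control T m) (j : Fin (m + 1))
    (w : List (Fin (m + 1))) (hw : ContinuousOn (controlIter u w) (Icc 0 T)) {t : ℝ}
    (ht : t ∈ Icc 0 T) :
    controlIter u (j :: w) t = ∫ s in (0 : ℝ)..t, controlIter u w s * channel u j s := by
  have h0 : (0 : ℝ) ∈ Icc 0 T := ⟨le_rfl, ht.1.trans ht.2⟩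
  have hsub : Icc 0 t ⊆ Icc 0 T := Icc_subset_Icc le_rfl ht.2
  exact stieltjesIntegral_eq ht.1 (hasStieltjesIntegral_primitive ht.1 (hw.mono hsub)
    (intervalIntegrable_channel u j h0 ht) fun s hs t ht =>
      timeExtend_sub u j (hsub hs) (hsub ht))

theorem continuousOn_controlIter (u : Control T m) (w : List (Fin (m + 1))) :
    ContinuousOn (controlIter u w) (Icc 0 T) := by
  induction w with
  | nil => exact continuousOn_const
  | cons j w ih =>
    rcases lt_or_ge T 0 with hT | hT
    · simp [Icc_eq_empty (not_le.2 hT)]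
    have h0 : (0 : ℝ) ∈ Icc 0 T := ⟨le_rfl, hT⟩
    have h1 : (T : ℝ) ∈ Icc 0 T := ⟨hT, le_rfl⟩
    refine ContinuousOn.congr ?_ fun t ht => controlIter_cons_of_continuousOn u j w ih ht
    have hint : IntervalIntegrable (fun s => controlIter u w s * channel u j s) volume 0 T :=
      (intervalIntegrable_channel u j h0 h1).continuousOn_mul (by rwa [uIcc_of_le hT])
    have := intervalIntegral.continuousOn_primitive_interval'
      (b₁ := 0) (b₂ := T) (a := 0) hint (by simp)
    rwa [uIcc_of_le hT] at this

theorem controlIter_cons (u : Control T m) (j : Fin (m + 1)) (w : List (Fin (m + 1))) {t : ℝ}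
    (ht : t ∈ Icc 0 T) :
    controlIter u (j :: w) t = ∫ s in (0 : ℝ)..t, controlIter u w s * channel u j s :=
  controlIter_cons_of_continuousOn u j w (continuousOn_controlIter u w) ht

theorem intervalIntegrable_mul_channel {u : Control T m} {g : ℝ → ℝ}
    (hg : ContinuousOn g (Icc 0 T)) (j : Fin (m + 1)) {t : ℝ} (ht : t ∈ Icc 0 T) :
    IntervalIntegrable (fun s => g s * channel u j s) volume 0 t :=
  (intervalIntegrable_channel u j ⟨le_rfl, ht.1.trans ht.2⟩ ht).continuousOn_mul (by
    rw [uIcc_of_le ht.1]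
    exact hg.mono (Icc_subset_Icc le_rfl ht.2))

/-! ### Products of iterated integrals -/

theorem continuousOn_pairing (u : Control T m) (l : Weights (m + 1)) :
    ContinuousOn (fun t => pairing l fun w => controlIter u w t) (Icc 0 T) := by
  unfold pairing Finsupp.sum
  exact continuousOn_finsetSum _ fun w _ => continuousOn_const.mul (continuousOn_controlIter u w)

theorem pairing_mapDomain_cons (u : Control T m) (j : Fin (m + 1)) (l : Weights (m + 1)) {t : ℝ}
    (ht : t ∈ Icc 0 T) :
    pairing (l.mapDomain (List.cons j)) (fun w => controlIter u w t) =
      ∫ s in (0 : ℝ)..t, pairing l (fun w => controlIter u w s) * channel u j s := by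
  unfold pairing
  rw [Finsupp.sum_mapDomain_index (by simp) (by intros; ring)]
  unfold Finsupp.sum
  simp_rw [Finset.sum_mul]
  rw [intervalIntegral.integral_finsetSum fun w _ => intervalIntegrable_mul_channel
    (g := fun s => l w * controlIter u w s)
    (continuousOn_const.mul (continuousOn_controlIter u w)) j ht]
  refine Finset.sum_congr rfl fun w _ => ?_
  rw [controlIter_cons u j w ht, ← intervalIntegral.integral_const_mul]
  simp_rw [mul_assoc]

theorem pairing_add {n : ℕ} (l l' : Weights n) (S : List (Fin n) → ℝ) :
    pairing (l + l') S = pairing l S + pairing l' S :=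
  Finsupp.sum_add_index' (by simp) (by intros; ring)

theorem pairing_single {n : ℕ} (w : List (Fin n)) (r : ℝ) (S : List (Fin n) → ℝ) :
    pairing (Finsupp.single w r) S = r * S w :=
  Finsupp.sum_single_index (by simp)

theorem pairing_smul {n : ℕ} (r : ℝ) (l : Weights n) (S : List (Fin n) → ℝ) :
    pairing (r • l) S = r * pairing l S := by
  unfold pairing
  rw [Finsupp.sum_smul_index (by simp), Finsupp.mul_sum]
  simp_rw [mul_assoc]

/-- Translates between the outermost-letter-first order of `iterInt` and the order of `signature`.
-/
theorem pairing_mapDomain_reverse {n : ℕ} (l : Weights n) (S : List (Fin n) → ℝ) :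
    pairing (l.mapDomain List.reverse) (fun w => S w.reverse) = pairing l S := by
  unfold pairing
  rw [Finsupp.sum_mapDomain_index (by simp) (by intros; ring)]
  simp

/-- A product of two iterated integrals is a linear combination of iterated integrals. -/
theorem exists_pairing_eq_controlIter_mul (T : ℝ) (w w' : List (Fin (m + 1))) :
    ∃ l : Weights (m + 1), ∀ (u : Control T m), ∀ t ∈ Icc 0 T,
      pairing l (fun w => controlIter u w t) = controlIter u w t * controlIter u w' t := by
  induction w generalizing w' with
  | nil => exact ⟨Finsupp.single w' 1, fun u t _ => by rw [pairing_single, controlIter_nil]⟩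
  | cons i w ih =>
    induction w' with
    | nil =>
      exact ⟨Finsupp.single (i :: w) 1, fun u t _ => by
        rw [pairing_single, controlIter_nil, mul_comm]⟩
    | cons j w' ih' =>
      obtain ⟨l, hl⟩ := ih (j :: w')
      obtain ⟨l', hl'⟩ := ih'
      -- The shuffle recursion: differentiating the product removes the outermost letter of one
      -- factor, `i` or `j`, and that letter becomes the outermost one of the result.
      refine ⟨l.mapDomain (List.cons i) + l'.mapDomain (List.cons j), fun u t ht => ?_⟩
      have hsub : Icc 0 t ⊆ Icc 0 T := Icc_subset_Icc le_rfl ht.2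
      have hc := continuousOn_controlIter u
      rw [pairing_add, pairing_mapDomain_cons u i l ht, pairing_mapDomain_cons u j l' ht,
        ← intervalIntegral.integral_add
          (intervalIntegrable_mul_channel (continuousOn_pairing u l) i ht)
          (intervalIntegrable_mul_channel (continuousOn_pairing u l') j ht),
        integral_primitive_mul_primitive ht.1
          (intervalIntegrable_mul_channel (hc w) i ht)
          (intervalIntegrable_mul_channel (hc w') j ht)
          (fun s hs => controlIter_cons u i w (hsub hs))
          (fun s hs => controlIter_cons u j w' (hsub hs))]
      refine intervalIntegral.integral_congr fun s hs => ?_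
      rw [uIcc_of_le ht.1] at hs
      rw [hl u s (hsub hs), hl' u s (hsub hs)]
      ring

/-- Bilinear extension of the shuffle identity; one weight serves all controls and times, as closure
under multiplication requires. -/
theorem exists_pairing_eq_pairing_mul (T : ℝ) (l l' : Weights (m + 1)) :
    ∃ l'' : Weights (m + 1), ∀ (u : Control T m), ∀ t ∈ Icc 0 T,
      pairing l'' (fun w => controlIter u w t) =
        pairing l (fun w => controlIter u w t) * pairing l' (fun w => controlIter u w t) := by
  choose P hP using exists_pairing_eq_controlIter_mul (m := m) T
  induction l using Finsupp.induction_linear with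
  | zero => exact ⟨0, fun u t _ => by simp [pairing]⟩
  | add a b ha hb =>
    obtain ⟨a', ha⟩ := ha
    obtain ⟨b', hb⟩ := hb
    exact ⟨a' + b', fun u t ht => by rw [pairing_add, pairing_add, ha u t ht, hb u t ht, add_mul]⟩
  | single w r =>
    induction l' using Finsupp.induction_linear with
    | zero => exact ⟨0, fun u t _ => by simp [pairing]⟩
    | add a b ha hb =>
      obtain ⟨a', ha⟩ := ha
      obtain ⟨b', hb⟩ := hb
      exact ⟨a' + b', fun u t ht => by
        rw [pairing_add, pairing_add, ha u t ht, hb u t ht, mul_add]⟩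
    | single w' r' =>
      refine ⟨(r * r') • P w w', fun u t ht => ?_⟩
      rw [pairing_smul, pairing_single, pairing_single, hP w w' u t ht]
      ring

/-! ### Iterated integrals determine the control -/

theorem controlIter_replicate_zero (u : Control T m) (k : ℕ) {t : ℝ} (ht : t ∈ Icc 0 T) :
    controlIter u (List.replicate k 0) t = t ^ k / k.factorial := by
  induction k generalizing t with
  | zero => simp [iterInt]
  | succ k ih =>
    rw [List.replicate_succ, controlIter_cons u 0 _ ht]
    have : ∀ s ∈ uIcc 0 t, controlIter u (List.replicate k 0) s * channel u 0 s =
        s ^ k * (k.factorial : ℝ)⁻¹ := fun s hs => by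
      rw [uIcc_of_le ht.1] at hs
      rw [ih ⟨hs.1, hs.2.trans ht.2⟩, channel_zero, mul_one, div_eq_mul_inv]
    rw [intervalIntegral.integral_congr this, intervalIntegral.integral_mul_const, integral_pow,
      Nat.factorial_succ]
    push_cast
    field_simp
    ring

theorem time_eq_of_controlIter_eq {u v : Control T m} {s t : ℝ} (hs : s ∈ Icc 0 T)
    (ht : t ∈ Icc 0 T) (h : ∀ w, controlIter u w s = controlIter v w t) : s = t := by
  have := h (List.replicate 1 0)
  rw [controlIter_replicate_zero u 1 hs, controlIter_replicate_zero v 1 ht] at this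
  simpa using this

theorem control_ae_eq_of_controlIter_eq {u v : Control T m} {t : ℝ} (ht : t ∈ Icc 0 T)
    (h : ∀ w, controlIter u w t = controlIter v w t) :
    ∀ᵐ s, s ∈ Ioo 0 t → u s = v s := by
  have h0 : (0 : ℝ) ∈ Icc 0 T := ⟨le_rfl, ht.1.trans ht.2⟩
  have key : ∀ i : Fin m, ∀ᵐ s, s ∈ Ioo 0 t → u s i - v s i = 0 := by
    intro i
    have hu := intervalIntegrable_channel u i.succ h0 ht
    have hv := intervalIntegrable_channel v i.succ h0 ht
    refine ae_eq_zero_of_moments ht.1 (hu.sub hv) fun k => ?_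
    -- The `k` inner time integrations produce `s ^ k / k!`, so this coordinate is a multiple of the
    -- `k`-th moment.
    have e : ∀ u : Control T m, controlIter u (i.succ :: List.replicate k 0) t =
        (k.factorial : ℝ)⁻¹ * ∫ s in (0 : ℝ)..t, s ^ k * channel u i.succ s := by
      intro u
      rw [controlIter_cons u _ _ ht, ← intervalIntegral.integral_const_mul]
      refine intervalIntegral.integral_congr fun s hs => ?_
      rw [uIcc_of_le ht.1] at hs
      rw [controlIter_replicate_zero u k ⟨hs.1, hs.2.trans ht.2⟩]
      ring
    have h1 := h (i.succ :: List.replicate k 0)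
    rw [e u, e v] at h1
    have h2 := mul_left_cancel₀ (by positivity) h1
    have hc : ContinuousOn (fun s : ℝ => s ^ k) (uIcc 0 t) := by fun_prop
    have h3 := intervalIntegral.integral_sub (hu.continuousOn_mul hc) (hv.continuousOn_mul hc)
    rw [h2, sub_self] at h3
    refine Eq.trans (intervalIntegral.integral_congr fun s _ => ?_) h3
    exact mul_sub _ _ _
  filter_upwards [ae_all_iff.2 key] with s hs hs'
  ext i
  exact sub_eq_zero.1 (hs i hs')

/-! ### Continuity in the control -/

/-- The `L¹` distance of two controls on `[0, t]`. -/
noncomputable def l1Dist (u v : Control T m) (t : ℝ) : ℝ := ∫ s in (0 : ℝ)..t, ‖u s - v s‖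

theorem l1Dist_nonneg (u v : Control T m) {t : ℝ} (ht : 0 ≤ t) : 0 ≤ l1Dist u v t :=
  intervalIntegral.integral_nonneg ht fun _ _ => norm_nonneg _

theorem integrableOn_sub (u v : Control T m) : IntegrableOn (fun s => u s - v s) (Icc 0 T) :=
  (integrableOn_control u).sub (integrableOn_control v)

theorem l1Dist_mono (u v : Control T m) {s t : ℝ} (hs : 0 ≤ s) (hst : s ≤ t) (ht : t ≤ T) :
    l1Dist u v s ≤ l1Dist u v t :=
  intervalIntegral.integral_mono_interval le_rfl hs hst
    (Filter.Eventually.of_forall fun _ => norm_nonneg _)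
    (intervalIntegrable_of_integrableOn (integrableOn_sub u v)
      ⟨le_rfl, (hs.trans hst).trans ht⟩ ⟨hs.trans hst, ht⟩).norm

/-- Cauchy–Schwarz on an interval of length `T`. -/
theorem l1Dist_le (hT : 0 ≤ T) (u v : Control T m) :
    l1Dist u v T ≤ ‖u - v‖ * T ^ (1 / 2 : ℝ) := by
  have hsub := Lp.coeFn_sub u v
  have e1 : l1Dist u v T = ∫ s, ‖(u - v : Control T m) s‖ ∂(volume.restrict (Icc 0 T)) := by
    rw [l1Dist, intervalIntegral.integral_of_le hT, ← integral_Icc_eq_integral_Ioc]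
    refine integral_congr_ae ?_
    filter_upwards [hsub] with s hs
    rw [hs, Pi.sub_apply]
  rw [e1, integral_norm_eq_lintegral_enorm (Lp.aestronglyMeasurable _),
    ← eLpNorm_one_eq_lintegral_enorm, Lp.norm_def]
  have h := eLpNorm_le_eLpNorm_mul_rpow_measure_univ (μ := volume.restrict (Icc (0 : ℝ) T))
    (p := 1) (q := 2) one_le_two (Lp.aestronglyMeasurable (u - v))
  have hm : (volume.restrict (Icc (0 : ℝ) T)) univ = ENNReal.ofReal T := by simp
  rw [hm] at h
  have h2 := ENNReal.toReal_mono ?_ h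
  · rw [ENNReal.toReal_mul, ← ENNReal.toReal_rpow, ENNReal.toReal_ofReal hT] at h2
    norm_num at h2 ⊢
    exact h2
  · exact ENNReal.mul_ne_top (Lp.eLpNorm_ne_top _)
      (ENNReal.rpow_ne_top_of_nonneg (by norm_num) ENNReal.ofReal_ne_top)

open Filter Topology

theorem tendsto_l1Dist (hT : 0 ≤ T) (v : Control T m) :
    Tendsto (fun u => l1Dist u v T) (𝓝 v) (𝓝 0) := by
  refine squeeze_zero (fun u => l1Dist_nonneg u v hT) (fun u => l1Dist_le hT u v) ?_
  have : Tendsto (fun u : Control T m => ‖u - v‖ * T ^ (1 / 2 : ℝ)) (𝓝 v)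
      (𝓝 (‖v - v‖ * T ^ (1 / 2 : ℝ))) := by
    apply Continuous.tendsto
    fun_prop
  simpa using this

theorem tendstoUniformlyOn_controlIter (hT : 0 ≤ T) (v : Control T m) (w : List (Fin (m + 1))) :
    TendstoUniformlyOn (fun u => controlIter u w) (controlIter v w) (𝓝 v) (Icc 0 T) := by
  induction w with
  | nil =>
    rw [Metric.tendstoUniformlyOn_iff]
    intro ε hε
    exact Eventually.of_forall fun u t _ => by
      rwa [controlIter_nil, controlIter_nil, dist_self]
  | cons j w ih =>
    rw [Metric.tendstoUniformlyOn_iff] at ih ⊢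
    intro ε hε
    have h0 : (0 : ℝ) ∈ Icc 0 T := ⟨le_rfl, hT⟩
    have h1 : T ∈ Icc 0 T := ⟨hT, le_rfl⟩
    obtain ⟨M, hM⟩ := isCompact_Icc.exists_bound_of_continuousOn (continuousOn_controlIter v w)
    have hM0 : 0 ≤ M := (norm_nonneg _).trans (hM 0 h0)
    set A := ∫ s in (0 : ℝ)..T, |channel v j s|
    have hA : 0 ≤ A := intervalIntegral.integral_nonneg hT fun _ _ => abs_nonneg _
    -- The bound `δ ≤ 1` gives `|controlIter u w| ≤ M + 1` for nearby `u`; the other bound makes the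
    -- second error term less than `ε / 2`.
    set δ := min 1 (ε / (2 * (A + 1)))
    have hδ : 0 < δ := lt_min one_pos (by positivity)
    have hδ1 : δ ≤ 1 := min_le_left _ _
    have hδA : δ * A < ε / 2 := by
      have : δ ≤ ε / (2 * (A + 1)) := min_le_right _ _
      rw [le_div_iff₀ (by positivity)] at this
      nlinarith
    have hN : ∀ᶠ u in 𝓝 v, l1Dist u v T < ε / (2 * (M + 1)) :=
      (tendsto_l1Dist hT v).eventually_lt_const (by positivity)
    filter_upwards [ih δ hδ, hN] with u hu hN t ht
    rw [lt_div_iff₀ (by positivity)] at hN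
    have hsub : Icc 0 t ⊆ Icc 0 T := Icc_subset_Icc le_rfl ht.2
    rw [controlIter_cons u j w ht, controlIter_cons v j w ht, dist_comm, Real.dist_eq,
      ← intervalIntegral.integral_sub
        (intervalIntegrable_mul_channel (continuousOn_controlIter u w) j ht)
        (intervalIntegrable_mul_channel (continuousOn_controlIter v w) j ht), ← Real.norm_eq_abs]
    refine (intervalIntegral.norm_integral_le_integral_norm ht.1).trans_lt ?_
    have i1 : IntervalIntegrable (fun s => (M + 1) * ‖u s - v s‖) volume 0 t :=
      (intervalIntegrable_of_integrableOn (integrableOn_sub u v) h0 ht).norm.const_mul _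
    have i2 : IntervalIntegrable (fun s => δ * |channel v j s|) volume 0 t :=
      (intervalIntegrable_channel v j h0 ht).abs.const_mul _
    have hle : ∫ s in (0 : ℝ)..t, ‖controlIter u w s * channel u j s -
        controlIter v w s * channel v j s‖ ≤
        ∫ s in (0 : ℝ)..t, ((M + 1) * ‖u s - v s‖ + δ * |channel v j s|) := by
      refine intervalIntegral.integral_mono_on ht.1
        ((intervalIntegrable_mul_channel (continuousOn_controlIter u w) j ht).sub
          (intervalIntegrable_mul_channel (continuousOn_controlIter v w) j ht)).norm
        (i1.add i2) fun s hs => ?_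
      have hd := (hu s (hsub hs)).le
      rw [dist_comm, Real.dist_eq] at hd
      have hMs := hM s (hsub hs)
      rw [Real.norm_eq_abs] at hMs ⊢
      have hub : |controlIter u w s| ≤ M + 1 := by
        have := abs_sub_abs_le_abs_sub (controlIter u w s) (controlIter v w s)
        linarith
      have e : controlIter u w s * channel u j s - controlIter v w s * channel v j s =
          controlIter u w s * (channel u j s - channel v j s) +
          (controlIter u w s - controlIter v w s) * channel v j s := by ring
      rw [e]
      refine (abs_add_le _ _).trans ?_
      rw [abs_mul, abs_mul]
      gcongr
      exact abs_channel_sub_le u v j s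
    refine hle.trans_lt ?_
    rw [intervalIntegral.integral_add i1 i2, intervalIntegral.integral_const_mul,
      intervalIntegral.integral_const_mul]
    have hNt : l1Dist u v t ≤ l1Dist u v T := l1Dist_mono u v ht.1 ht.2 le_rfl
    have hAt : ∫ s in (0 : ℝ)..t, |channel v j s| ≤ A :=
      intervalIntegral.integral_mono_interval le_rfl ht.1 ht.2
        (Eventually.of_forall fun _ => abs_nonneg _) (intervalIntegrable_channel v j h0 h1).abs
    have hNt' : (M + 1) * ∫ s in (0 : ℝ)..t, ‖u s - v s‖ ≤ (M + 1) * l1Dist u v T :=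
      mul_le_mul_of_nonneg_left hNt (by positivity)
    have hAt' := mul_le_mul_of_nonneg_left hAt hδ.le
    linarith

end

end SigControl

/-! ### Trajectories: dependence on the control, and approximation -/

namespace SigControl

section
variable {T : ℝ} {d m : ℕ}
  {f₀ : EuclideanSpace ℝ (Fin d) → EuclideanSpace ℝ (Fin d)}
  {f : EuclideanSpace ℝ (Fin d) → Matrix (Fin d) (Fin m) ℝ} {x₀ : EuclideanSpace ℝ (Fin d)}

/-- The asymmetric splitting `(f a - f b) p + f b (p - q)` requires a bound on `f` at `b` only. With
`b` on a fixed reference trajectory, no uniform bound on the other trajectories is needed. -/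
theorem norm_drift_sub_le {L₀ L : ℝ≥0} (hf₀ : LipschitzWith L₀ f₀) (hf : LipschitzWith L f)
    (a b : EuclideanSpace ℝ (Fin d)) (p q : EuclideanSpace ℝ (Fin m)) :
    ‖drift f₀ f a p - drift f₀ f b q‖ ≤ (L₀ + L * ‖p‖) * ‖a - b‖ + ‖f b‖ * ‖p - q‖ := by
  have e : drift f₀ f a p - drift f₀ f b q = (f₀ a - f₀ b) +
      WithLp.toLp 2 ((f a - f b) *ᵥ p.ofLp) + WithLp.toLp 2 (f b *ᵥ (p - q).ofLp) := by
    ext i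
    simp only [drift, Matrix.sub_mulVec, WithLp.ofLp_sub, Matrix.mulVec_sub, PiLp.sub_apply,
      PiLp.add_apply, Pi.sub_apply]
    ring
  have h1 : ‖f₀ a - f₀ b‖ ≤ L₀ * ‖a - b‖ := by simpa [dist_eq_norm] using hf₀.dist_le_mul a b
  have h2 : ‖f a - f b‖ ≤ L * ‖a - b‖ := by simpa [dist_eq_norm] using hf.dist_le_mul a b
  have h3 : ‖WithLp.toLp 2 ((f a - f b) *ᵥ p.ofLp)‖ ≤ ‖f a - f b‖ * ‖p‖ :=
    (f a - f b).l2_opNorm_mulVec p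
  have h4 : ‖WithLp.toLp 2 (f b *ᵥ (p - q).ofLp)‖ ≤ ‖f b‖ * ‖p - q‖ :=
    (f b).l2_opNorm_mulVec (p - q)
  have h5 := mul_le_mul_of_nonneg_right h2 (norm_nonneg p)
  rw [e]
  refine (norm_add₃_le).trans ?_
  linarith

/-- The trajectories of two controls differ by at most a constant multiple of their `L¹`
distance. -/
theorem IsSolution.norm_sub_le {L₀ L : ℝ≥0} (hf₀ : LipschitzWith L₀ f₀) (hf : LipschitzWith L f)
    {u v : Control T m} {x y : ℝ → EuclideanSpace ℝ (Fin d)} (hx : IsSolution f₀ f x₀ u x)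
    (hy : IsSolution f₀ f x₀ v y) {M : ℝ} (hM : ∀ s ∈ Icc 0 T, ‖f (y s)‖ ≤ M) {t : ℝ}
    (ht : t ∈ Icc 0 T) :
    ‖x t - y t‖ ≤ M * l1Dist u v t * Real.exp (∫ s in (0 : ℝ)..t, (L₀ + L * ‖u s‖)) := by
  have h0 : (0 : ℝ) ∈ Icc 0 T := ⟨le_rfl, ht.1.trans ht.2⟩
  have hM0 : 0 ≤ M := (norm_nonneg _).trans (hM 0 h0)
  have hzc : ContinuousOn (fun s => ‖x s - y s‖) (Icc 0 T) :=
    (hx.continuousOn.sub hy.continuousOn).norm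
  have ha : ∀ s ∈ Icc 0 T, IntervalIntegrable (fun s => (L₀ + L * ‖u s‖ : ℝ)) volume 0 s :=
    fun s hs => intervalIntegrable_const.add
      ((intervalIntegrable_control u h0 hs).norm.const_mul _)
  have hsub : Icc 0 t ⊆ Icc 0 T := Icc_subset_Icc le_rfl ht.2
  refine le_mul_exp_of_le_add_integral ht.1 (hzc.mono hsub) (ha t ht)
    (fun s => by positivity) fun s hs => ?_
  have hsT := hsub hs
  have iu := intervalIntegrable_of_integrableOn hx.integrableOn h0 hsT
  have iv := intervalIntegrable_of_integrableOn hy.integrableOn h0 hsT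
  have i1 : IntervalIntegrable (fun r => (L₀ + L * ‖u r‖ : ℝ) * ‖x r - y r‖) volume 0 s :=
    (ha s hsT).mul_continuousOn (by
      rw [uIcc_of_le hs.1]
      exact hzc.mono (Icc_subset_Icc le_rfl hsT.2))
  have i2 : IntervalIntegrable (fun r => M * ‖u r - v r‖) volume 0 s :=
    (intervalIntegrable_of_integrableOn (integrableOn_sub u v) h0 hsT).norm.const_mul _
  rw [hx.eq_integral s hsT, hy.eq_integral s hsT, add_sub_add_left_eq_sub,
    ← intervalIntegral.integral_sub iu iv]
  refine (intervalIntegral.norm_integral_le_integral_norm hs.1).trans ?_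
  have hle : ∫ r in (0 : ℝ)..s, ‖drift f₀ f (x r) (u r) - drift f₀ f (y r) (v r)‖ ≤
      ∫ r in (0 : ℝ)..s, (M * ‖u r - v r‖ + (L₀ + L * ‖u r‖) * ‖x r - y r‖) := by
    refine intervalIntegral.integral_mono_on hs.1 (iu.sub iv).norm (i2.add i1) fun r hr => ?_
    refine (norm_drift_sub_le hf₀ hf _ _ _ _).trans ?_
    have := mul_le_mul_of_nonneg_right (hM r ⟨hr.1, hr.2.trans hsT.2⟩) (norm_nonneg (u r - v r))
    linarith
  refine hle.trans ?_
  rw [intervalIntegral.integral_add i2 i1, intervalIntegral.integral_const_mul]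
  have := mul_le_mul_of_nonneg_left (l1Dist_mono u v hs.1 hs.2 ht.2) hM0
  unfold l1Dist at this ⊢
  linarith

theorem IsSolution.exists_bound {L : ℝ≥0} (hf : LipschitzWith L f) {v : Control T m}
    {y : ℝ → EuclideanSpace ℝ (Fin d)} (hy : IsSolution f₀ f x₀ v y) :
    ∃ M, ∀ s ∈ Icc 0 T, ‖f (y s)‖ ≤ M :=
  isCompact_Icc.exists_bound_of_continuousOn (hf.continuous.comp_continuousOn hy.continuousOn)

/-- Solutions at time `t` depend on the control on `[0, t]` only. -/
theorem IsSolution.eq_of_ae_eq {L₀ L : ℝ≥0} (hf₀ : LipschitzWith L₀ f₀) (hf : LipschitzWith L f)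
    {u v : Control T m} {x y : ℝ → EuclideanSpace ℝ (Fin d)} (hx : IsSolution f₀ f x₀ u x)
    (hy : IsSolution f₀ f x₀ v y) {t : ℝ} (ht : t ∈ Icc 0 T)
    (h : ∀ᵐ s, s ∈ Ioo 0 t → u s = v s) : x t = y t := by
  obtain ⟨M, hM⟩ := hy.exists_bound hf
  have hN : l1Dist u v t = 0 := by
    rw [l1Dist, intervalIntegral.integral_of_le ht.1, integral_Ioc_eq_integral_Ioo]
    refine integral_eq_zero_of_ae ?_
    rw [Filter.EventuallyEq, ae_restrict_iff' measurableSet_Ioo]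
    filter_upwards [h] with s hs hs'
    simp [hs hs']
  have := hx.norm_sub_le hf₀ hf hy hM ht
  rw [hN, mul_zero, zero_mul] at this
  exact sub_eq_zero.1 (norm_le_zero_iff.1 this)

open Filter Topology

theorem tendstoUniformlyOn_solution (hT : 0 ≤ T) {L₀ L : ℝ≥0} (hf₀ : LipschitzWith L₀ f₀)
    (hf : LipschitzWith L f) {K : Set (Control T m)}
    {x : Control T m → ℝ → EuclideanSpace ℝ (Fin d)}
    (hx : ∀ u ∈ K, IsSolution f₀ f x₀ u (x u)) {v : Control T m} (hv : v ∈ K) :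
    TendstoUniformlyOn x (x v) (𝓝[K] v) (Icc 0 T) := by
  obtain ⟨M, hM⟩ := (hx v hv).exists_bound hf
  have h0 : (0 : ℝ) ∈ Icc 0 T := ⟨le_rfl, hT⟩
  have h1 : T ∈ Icc 0 T := ⟨hT, le_rfl⟩
  have hM0 : 0 ≤ M := (norm_nonneg _).trans (hM 0 h0)
  set A := ∫ s in (0 : ℝ)..T, ‖v s‖
  -- The exponent bounds the Grönwall factor of `u` through `‖u‖ ≤ ‖v‖ + ‖u - v‖`, leaving a
  -- function of the `L¹` distance alone.
  have hlim : Tendsto (fun u => M * l1Dist u v T * Real.exp (L₀ * T + L * (A + l1Dist u v T)))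
      (𝓝[K] v) (𝓝 0) := by
    have hc : Continuous fun r : ℝ => M * r * Real.exp (L₀ * T + L * (A + r)) := by fun_prop
    have := (hc.tendsto 0).comp ((tendsto_l1Dist hT v).mono_left (nhdsWithin_le_nhds (s := K)))
    rw [mul_zero, zero_mul] at this
    exact this
  rw [Metric.tendstoUniformlyOn_iff]
  intro ε hε
  filter_upwards [hlim.eventually_lt_const hε, self_mem_nhdsWithin] with u hu huK t ht
  rw [dist_comm, dist_eq_norm]
  refine lt_of_le_of_lt ?_ hu
  refine ((hx u huK).norm_sub_le hf₀ hf (hx v hv) hM ht).trans ?_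
  have hN : l1Dist u v t ≤ l1Dist u v T := l1Dist_mono u v ht.1 ht.2 le_rfl
  have hN0 : 0 ≤ l1Dist u v T := l1Dist_nonneg u v hT
  have iu := (intervalIntegrable_control u h0 h1).norm
  have iv := (intervalIntegrable_control v h0 h1).norm
  have iuv := (intervalIntegrable_of_integrableOn (integrableOn_sub u v) h0 h1).norm
  have hu1 : ∫ s in (0 : ℝ)..T, ‖u s‖ ≤ A + l1Dist u v T := by
    rw [l1Dist, ← intervalIntegral.integral_add iv iuv]
    refine intervalIntegral.integral_mono_on hT iu (iv.add iuv) fun s _ => ?_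
    have := norm_add_le (v s) (u s - v s)
    rwa [add_sub_cancel] at this
  have hu2 : ∫ s in (0 : ℝ)..t, (L₀ + L * ‖u s‖ : ℝ) ≤ L₀ * T + L * (A + l1Dist u v T) := by
    have h2 : ∫ s in (0 : ℝ)..t, (L₀ + L * ‖u s‖ : ℝ) ≤ ∫ s in (0 : ℝ)..T, (L₀ + L * ‖u s‖ : ℝ) :=
      intervalIntegral.integral_mono_interval le_rfl ht.1 ht.2
        (Eventually.of_forall fun s => by positivity)
        (intervalIntegrable_const.add (iu.const_mul _))
    refine h2.trans ?_
    rw [intervalIntegral.integral_add intervalIntegrable_const (iu.const_mul _),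
      intervalIntegral.integral_const, intervalIntegral.integral_const_mul, smul_eq_mul, sub_zero,
      mul_comm T]
    gcongr
  gcongr

/-- Approximation of a continuous function of the solution by linear functionals of the
signature. -/
theorem exists_pairing_near (hT : 0 ≤ T) {L₀ L : ℝ≥0} (hf₀ : LipschitzWith L₀ f₀)
    (hf : LipschitzWith L f) {K : Set (Control T m)} (hK : IsCompact K)
    {x : Control T m → ℝ → EuclideanSpace ℝ (Fin d)}
    (hx : ∀ u ∈ K, IsSolution f₀ f x₀ u (x u)) {φ : EuclideanSpace ℝ (Fin d) → ℝ}
    (hφ : Continuous φ) {ε : ℝ} (hε : 0 < ε) :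
    ∃ l : Weights (m + 1), ∀ t ∈ Icc 0 T, ∀ u ∈ K,
      |φ (x u t) - pairing l (fun w => controlIter u w t)| < ε := by
  have : CompactSpace K := isCompact_iff_compactSpace.1 hK
  let X := Icc (0 : ℝ) T × K
  have hF : ∀ w : List (Fin (m + 1)), Continuous fun p : X => controlIter p.2.1 w p.1 := fun w =>
    continuous_uncurry_of_tendstoUniformlyOn (h := fun u => controlIter u w)
      (fun v _ => continuousOn_controlIter v w) fun v _ =>
        fun s hs => (tendstoUniformlyOn_controlIter hT v w s hs).filter_mono nhdsWithin_le_nhds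
  have hy : Continuous fun p : X => φ (x p.2 p.1) :=
    hφ.comp (continuous_uncurry_of_tendstoUniformlyOn (fun v hv => (hx v hv).continuousOn)
      fun v hv => tendstoUniformlyOn_solution hT hf₀ hf hx hv)
  let A : Subalgebra ℝ C(X, ℝ) :=
    { carrier := {g | ∃ l : Weights (m + 1), ∀ p : X,
        g p = pairing l fun w => controlIter p.2.1 w p.1}
      mul_mem' := by
        rintro g g' ⟨l, hl⟩ ⟨l', hl'⟩
        obtain ⟨l'', h⟩ := exists_pairing_eq_pairing_mul T l l'
        exact ⟨l'', fun p => by rw [h _ _ p.1.2, ← hl, ← hl']; rfl⟩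
      add_mem' := by
        rintro g g' ⟨l, hl⟩ ⟨l', hl'⟩
        exact ⟨l + l', fun p => by rw [pairing_add, ← hl, ← hl']; rfl⟩
      algebraMap_mem' := fun r => ⟨Finsupp.single [] r, fun p => by
        rw [pairing_single, controlIter_nil, mul_one]; rfl⟩ }
  have hmem : (⟨_, hy⟩ : C(X, ℝ)) ∈ A.topologicalClosure := by
    refine A.mem_topologicalClosure_of_constant_on_fibres _ ?_
    -- On a joint fibre the times coincide and the controls agree almost everywhere up to that time,
    -- so causality equates the outputs.
    rintro ⟨⟨s, hs⟩, ⟨u, hu⟩⟩ ⟨⟨t, ht⟩, ⟨v, hv⟩⟩ h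
    have hw : ∀ w, controlIter u w s = controlIter v w t := fun w =>
      h ⟨_, hF w⟩ ⟨Finsupp.single w 1, fun p => by rw [pairing_single, one_mul]; rfl⟩
    obtain rfl := time_eq_of_controlIter_eq hs ht hw
    exact congrArg φ ((hx u hu).eq_of_ae_eq hf₀ hf (hx v hv) hs
      (control_ae_eq_of_controlIter_eq hs hw))
  obtain ⟨g, ⟨l, hl⟩, hg⟩ := Metric.mem_closure_iff.1 hmem ε hε
  refine ⟨l, fun t ht u hu => ?_⟩
  have := (ContinuousMap.dist_apply_le_dist (⟨⟨t, ht⟩, ⟨u, hu⟩⟩ : X)).trans_lt hg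
  rw [hl, Real.dist_eq] at this
  exact this

theorem continuous_of_lipschitz_on_balls {E F : Type*} [NormedAddCommGroup E]
    [NormedAddCommGroup F] {c : E → F} (hc : ∀ R : ℝ, 0 < R → ∃ L : ℝ, 0 < L ∧ ∀ x z : E,
      ‖x‖ ≤ R → ‖z‖ ≤ R → ‖c x - c z‖ ≤ L * ‖x - z‖) : Continuous c := by
  rw [continuous_iff_continuousAt]
  intro a
  obtain ⟨L, hL, h⟩ := hc (‖a‖ + 1) (by positivity)
  have hs : Metric.closedBall (0 : E) (‖a‖ + 1) ∈ 𝓝 a :=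
    Metric.closedBall_mem_nhds_of_mem (by simp)
  have hlip : LipschitzOnWith L.toNNReal c (Metric.closedBall (0 : E) (‖a‖ + 1)) := by
    refine LipschitzOnWith.of_dist_le_mul fun y hy z hz => ?_
    rw [dist_eq_norm, dist_eq_norm, Real.coe_toNNReal _ hL.le]
    exact h y z (by simpa using hy) (by simpa using hz)
  exact hlip.continuousOn.continuousAt hs

end

end SigControl

theorem theorem3p5 {d m p : ℕ} {T : ℝ} (hT : 0 < T)
    (f₀ : EuclideanSpace ℝ (Fin d) → EuclideanSpace ℝ (Fin d))
    (f : EuclideanSpace ℝ (Fin d) → Matrix (Fin d) (Fin m) ℝ)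
    (c : EuclideanSpace ℝ (Fin d) → EuclideanSpace ℝ (Fin p))
    (x₀ : EuclideanSpace ℝ (Fin d))
    (hf₀ : ∃ L : ℝ≥0, LipschitzWith L f₀)
    (hf : ∃ L : ℝ≥0, LipschitzWith L f)
    (hc : ∀ R : ℝ, 0 < R → ∃ L : ℝ, 0 < L ∧ ∀ x z : EuclideanSpace ℝ (Fin d), ‖x‖ ≤ R → ‖z‖ ≤ R →
      ‖c x - c z‖ ≤ L * ‖x - z‖)
    (K : Set (SigControl.Control T m)) (hK : IsCompact K)
    (x : SigControl.Control T m → ℝ → EuclideanSpace ℝ (Fin d))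
    (hx : ∀ u ∈ K, SigControl.IsSolution f₀ f x₀ u (x u))
    (i : Fin p) (ε : ℝ) (hε : 0 < ε) :
    ∃ l : SigControl.Weights (m + 1),
      (⨆ t ∈ Icc (0 : ℝ) T, ⨆ u ∈ K,
        ENNReal.ofReal |c (x u t) i - SigControl.pairing l (SigControl.signature
          (SigControl.timeExtend (SigControl.integralPath u)) 0 t)|) < ENNReal.ofReal ε := by
  obtain ⟨L₀, hL₀⟩ := hf₀
  obtain ⟨L, hL⟩ := hf
  have hφ : Continuous fun z => c z i :=
    (EuclideanSpace.proj (𝕜 := ℝ) i).continuous.comp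
      (SigControl.continuous_of_lipschitz_on_balls hc)
  -- Half of `ε`, since strict pointwise bounds yield only a weak bound on the supremum.
  obtain ⟨l, hl⟩ := SigControl.exists_pairing_near hT.le hL₀ hL hK hx hφ (half_pos hε)
  refine ⟨l.mapDomain List.reverse, ?_⟩
  refine lt_of_le_of_lt ?_ ((ENNReal.ofReal_lt_ofReal_iff hε).2 (half_lt_self hε))
  refine iSup₂_le fun t ht => iSup₂_le fun u hu => ENNReal.ofReal_le_ofReal ?_
  have e := SigControl.pairing_mapDomain_reverse l fun w => SigControl.controlIter u w t
  unfold SigControl.signature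
  rw [e]
  exact (hl t ht u hu).le
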